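/- Let $k,q\ge 1$ be integers and let $T_{k,q}$ be the edgewise subdivision of the $(k-1)$-simplex $\{0\le x_1\le\dots\le x_{k-1}\le q\}$: its vertex set is $W_{k,q}=\{\mathbf v\in\mathbb Z^{k-1}:0\le v_1\le\dots\le v_{k-1}\le q\}$, and its facets are the simplices with vertices $\mathbf v,\ \mathbf v+e_{\pi_{k-1}},\ \dots,\ \mathbf v+e_{\pi_{k-1}}+\dots+e_{\pi_1}$, all lying in $W_{k,q}$, where $\pi\in\mathbb S_{k-1}$ is a permutation in which $i$ stands before $i+1$ whenever $v_i=v_{i+1}$. For a partition $\sigma=(\sigma^1,\dots,\sigma^r)$ of a positive integer let $P_\sigma=C_{\sigma^1}\times\dots\times C_{\sigma^r}$, where $C_m=\{0<1<\dots<m\}$, and let $K_\sigma=\Delta(P_\sigma\setminus\{\hat 0,\hat 1\})$ be its reduced order complex. Let $F$ be a $(t-1)$-dimensional face of $T_{k,q}$, $t\ge1$, with vertices $\mathbf v^{(1)}<\dots<\mathbf v^{(t)}$ in the componentwise order. For $i<t$ let $S_i\subseteq[k-1]$ be the set of indices of the coordinates in which $\mathbf v^{(i)}$ and $\mathbf v^{(i+1)}$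 differ, and let $S_t=[k]\setminus(S_1\cup\dots\cup S_{t-1})$. Put $\lambda_i=|S_i|$, and let $\sigma_i$ be the partition of $\lambda_i$ whose parts are the sizes of the classes into which $S_i$ is divided according to the values of the coordinates of $\mathbf v^{(i)}$, where the index $k$ and the indices of all coordinates equal to $0$ or $q$ are regarded as one class. Then $\lambda=(\lambda_1,\dots,\lambda_t)$ is a partition of $k$ into $t$ parts (up to the order of the parts), the pair $(\lambda,M)$ with the multiset $M=\{\sigma_1,\dots,\sigma_t\}$ is well defined and uniquely determined by $F$, and $$\mathrm{link}_{T_{k,q}}(F)\;\cong\;K_{\sigma_1}*K_{\sigma_2}*\dots*K_{\sigma_t},$$ a join of $t$ reduced order complexes of products of chains. In particular the combinatorial type of the link is determined by $(\lambda,M)$: any two faces of $T_{k,q}$ with the same pair have isomorphic links. -/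

import Mathlib

namespace EdgewiseLinks

/-! ### Simplicial complexes

Abstract simplicial complexes are Mathlib's `PreAbstractSimplicialComplex`: the nonempty faces are
listed, the empty face is understood to belong to every complex, and points of the ambient type
need not be vertices. -/

section Complexes

/-- The vertices of `K`. -/
def vertexSet {V : Type*} (K : PreAbstractSimplicialComplex V) : Set V :=
  {v | ({v} : Finset V) ∈ K.faces}

/-- `K ≅ L`: there is a bijection between the vertex sets under which faces correspond to faces. -/
def Isomorphic {V W : Type*} (K : PreAbstractSimplicialComplex V)
    (L : PreAbstractSimplicialComplex W) : Prop :=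
  ∃ e : vertexSet K ≃ vertexSet L, ∀ s : Finset (vertexSet K),
    s.map (Function.Embedding.subtype _) ∈ K.faces ↔
      (s.map e.toEmbedding).map (Function.Embedding.subtype _) ∈ L.faces

/-- The link of a face `F`: all `s` with `F ∩ s = ∅` and `F ∪ s` a face. -/
def link {V : Type*} [DecidableEq V] (K : PreAbstractSimplicialComplex V) (F : Finset V) :
    PreAbstractSimplicialComplex V where
  faces := {s | s.Nonempty ∧ F ∩ s = ∅ ∧ F ∪ s ∈ K.faces}
  isRelLowerSet_faces := by
    rintro s ⟨hs, hd, hu⟩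
    refine ⟨hs, fun u hus hu' => ⟨hu', ?_, ?_⟩⟩
    · exact Finset.subset_empty.1 (hd ▸ Finset.inter_subset_inter_left hus)
    · exact (K.isRelLowerSet_faces hu).2 (Finset.union_subset_union_right hus)
        (hu'.mono Finset.subset_union_right)

/-- The join of a family of complexes, on the disjoint union of the vertices: a face is a disjoint
union of faces (possibly empty) of the members. -/
def join {ι : Type*} {V : ι → Type*} (K : ∀ i, PreAbstractSimplicialComplex (V i)) :
    PreAbstractSimplicialComplex (Σ i, V i) where
  faces := {s | s.Nonempty ∧ ∀ i,
    s.preimage (Sigma.mk i) sigma_mk_injective.injOn = ∅ ∨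
    s.preimage (Sigma.mk i) sigma_mk_injective.injOn ∈ (K i).faces}
  isRelLowerSet_faces := by
    rintro s ⟨hs, h⟩
    refine ⟨hs, fun u hus hu => ⟨hu, fun i => ?_⟩⟩
    have hsub : u.preimage (Sigma.mk i) sigma_mk_injective.injOn ⊆
        s.preimage (Sigma.mk i) sigma_mk_injective.injOn := fun x hx => by
      rw [Finset.mem_preimage] at hx ⊢
      exact hus hx
    rcases Finset.eq_empty_or_nonempty
      (u.preimage (Sigma.mk i) sigma_mk_injective.injOn) with he | hne
    · exact Or.inl he
    · rcases h i with h0 | h1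
      · rw [h0] at hsub
        exact Or.inl (Finset.subset_empty.1 hsub)
      · exact Or.inr (((K i).isRelLowerSet_faces h1).2 hsub hne)

/-- The order complex `Δ(P)`: its faces are the finite chains of `P`. -/
def orderComplex (P : Type*) [PartialOrder P] : PreAbstractSimplicialComplex P where
  faces := {s | s.Nonempty ∧ IsChain (· ≤ ·) (s : Set P)}
  isRelLowerSet_faces := by
    rintro s ⟨hs, hc⟩
    exact ⟨hs, fun u hus hu => ⟨hu, hc.mono (Finset.coe_subset.2 hus)⟩⟩

/-- The reduced order complex `Δ(P \ {0̂, 1̂})`. -/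
def reducedOrderComplex (P : Type*) [PartialOrder P] [BoundedOrder P] :
    PreAbstractSimplicialComplex {x : P // x ≠ ⊥ ∧ x ≠ ⊤} :=
  orderComplex {x : P // x ≠ ⊥ ∧ x ≠ ⊤}

end Complexes

section ChainProducts

/-- The product `∏ C_m` over the members `m` of a multiset (with multiplicity), where
`C_m = {0 < 1 < ⋯ < m}` is the chain of length `m`; it carries the componentwise order. -/
abbrev ChainProduct (lengths : Multiset ℕ) : Type :=
  ∀ i : lengths.ToType, Fin (i.1 + 1)

/-- `K_σ = Δ(P_σ \ {0̂, 1̂})`, where `P_σ` is the product of the chains whose lengths are the parts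
of the partition `σ`. -/
def chainProductComplex {m : ℕ} (σ : m.Partition) :
    PreAbstractSimplicialComplex {x : ChainProduct σ.parts // x ≠ ⊥ ∧ x ≠ ⊤} :=
  reducedOrderComplex (ChainProduct σ.parts)

/-- The join of the complexes `K_σ`, one for each member `σ` (with multiplicity) of a multiset of
partitions. -/
def joinOfChainProductComplexes (M : Multiset (Σ m : ℕ, m.Partition)) :
    PreAbstractSimplicialComplex
      (Σ i : M.ToType, {x : ChainProduct i.1.2.parts // x ≠ ⊥ ∧ x ≠ ⊤}) :=
  join fun i : M.ToType => chainProductComplex i.1.2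

end ChainProducts

/-! ### The edgewise subdivision

Throughout `k = n + 1`; the coordinates are indexed by `Fin n` in place of `{1, …, k - 1}`, and
`Fin (n + 1)` stands for `{1, …, k}`, with `Fin.last n` in the role of `k`. -/

section Edgewise

/-- `W_{k,q}`: the integer points with `0 ≤ v₁ ≤ ⋯ ≤ v_{k-1} ≤ q`. -/
def latticePoints (n q : ℕ) : Set (Fin n → ℤ) :=
  {v | Monotone v ∧ ∀ i, 0 ≤ v i ∧ v i ≤ q}

/-- The permutation `π = π₁ ⋯ π_{k-1}` is consistent with `v`: `i` stands before `i + 1` in `π`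
whenever `v_i = v_{i+1}`. -/
def Consistent {n : ℕ} (v : Fin n → ℤ) (π : Equiv.Perm (Fin n)) : Prop :=
  ∀ i j : Fin n, (j : ℕ) = i + 1 → v i = v j → π.symm i < π.symm j

/-- `v` with the coordinates named by the last `m` letters of `π` increased by one. -/
def facetVertex {n : ℕ} (v : Fin n → ℤ) (π : Equiv.Perm (Fin n)) (m : Fin (n + 1)) :
    Fin n → ℤ :=
  v + ∑ j ∈ Finset.univ.filter (fun j : Fin n => n ≤ (j : ℕ) + m), Pi.single (π j) 1

/-- The vertex set of `F(v, π)`: the points `v, v + e_{π_{k-1}}, …, v + e_{π_{k-1}} + ⋯ + e_{π₁}`. -/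
def facet {n : ℕ} (v : Fin n → ℤ) (π : Equiv.Perm (Fin n)) : Finset (Fin n → ℤ) :=
  Finset.univ.image (facetVertex v π)

/-- The edgewise subdivision `T_{k,q}`, each simplex being given by its set of vertices. The facets
are the `F(v, π)` with `π` consistent with `v` and all vertices in `W_{k,q}`. -/
def edgewise (n q : ℕ) : PreAbstractSimplicialComplex (Fin n → ℤ) where
  faces := {s | s.Nonempty ∧ ∃ (v : Fin n → ℤ) (π : Equiv.Perm (Fin n)),
    v ∈ latticePoints n q ∧ Consistent v π ∧ (∀ w ∈ facet v π, w ∈ latticePoints n q) ∧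
      s ⊆ facet v π}
  isRelLowerSet_faces := by
    rintro s ⟨hs, v, π, hv, hc, hW, hsub⟩
    exact ⟨hs, fun u hus hu => ⟨hu, v, π, hv, hc, hW, hus.trans hsub⟩⟩

end Edgewise

/-! ### The pair `(λ, M)` of a face -/

section Pair

variable {n s : ℕ}

/-- `S_i`, for `i < t`: the indices of the coordinates in which `v⁽ⁱ⁾` and `v⁽ⁱ⁺¹⁾` differ. -/
def stepSet (v : Fin (s + 1) → Fin n → ℤ) (i : Fin s) : Finset (Fin (n + 1)) :=
  (Finset.univ.filter fun l : Fin n => v i.castSucc l ≠ v i.succ l).map Fin.castSuccEmb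

/-- `S_1, …, S_t` with `t = s + 1`, where `S_t = {1, …, k} \ (S_1 ∪ ⋯ ∪ S_{t-1})`. -/
def block (v : Fin (s + 1) → Fin n → ℤ) : Fin (s + 1) → Finset (Fin (n + 1)) :=
  Fin.snoc (α := fun _ => Finset (Fin (n + 1))) (stepSet v)
    (Finset.univ \ Finset.univ.biUnion (stepSet v))

/-- Two indices in the same block belong to the same chain if they carry equal coordinates of `w`;
the index `k`, the indices of coordinates `0` and the indices of coordinates `q` also belong
together. This function on indices separates exactly the chains. -/
def chainLabel (q : ℕ) (w : Fin n → ℤ) : Fin (n + 1) → ℤ :=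
  Fin.snoc (α := fun _ => ℤ) (fun l => if w l = q then 0 else w l) 0

/-- The lengths of the chains whose product is `P_{S_i}`: the sizes of the classes into which `S_i`
is divided by the coordinates of `v⁽ⁱ⁾`. -/
def chainLengths (q : ℕ) (v : Fin (s + 1) → Fin n → ℤ) (i : Fin (s + 1)) : Multiset ℕ :=
  ((block v i).image (chainLabel q (v i))).val.map fun x =>
    ((block v i).filter fun j => chainLabel q (v i) j = x).card

/-- `(λ, M)` is the pair of the face `F = {v⁽¹⁾ < ⋯ < v⁽ᵗ⁾}`: the parts of `λ` are the
`λ_i = |S_i|`, and `M` consists of the partitions `σ_i` whose parts are the lengths of the chains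
in `P_{S_i}`. -/
def IsPairOfFace (q : ℕ) (F : Finset (Fin n → ℤ)) (lam : (n + 1).Partition)
    (M : Multiset (Σ m : ℕ, m.Partition)) : Prop :=
  ∃ (s : ℕ) (v : Fin (s + 1) → Fin n → ℤ), StrictMono v ∧ Finset.univ.image v = F ∧
    lam.parts = Finset.univ.val.map (fun i => (block v i).card) ∧
    M.map (fun σ => σ.2.parts) = Finset.univ.val.map (chainLengths q v)

end Pair

end EdgewiseLinks

/-!
Call two integer points adjacent if they are comparable and lie in a common unit cube. The edgewise
subdivision is the clique complex of this relation on `W_{k,q}`: a clique is a chain inside a unit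
cube, and sorting the coordinates by the number of its points in which they are raised gives the
permutation of a facet containing it.

Append to every point the coordinate `0` of index `k`, and regard points as vectors modulo
constants. The points adjacent to `w` are then exactly the points `w + 1_A` for proper subsets `A`
of `{1, …, k}`; two of them are adjacent if and only if their sets are nested, and `w + 1_A` lies in
`W_{k,q}` if and only if `A` meets every class of equal coordinates of `w` in an upper set, for a
suitable cyclic order on the indices. Hence a face with least vertex `w` is a chain
`∅ = A_0 ⊂ ⋯ ⊂ A_t = {1, …, k}` of such sets, and its link consists of the sets comparable with all
members of the chain. It is the join of the order complexes of the open intervals `(A_{i-1}, A_i)`,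
and each interval is a product of chains because an upper set in a chain is determined by its size.
-/

namespace EdgewiseLinks

open Relation

section FlagComplexes

variable {U V W : Type*} {S : Set V} {T : Set W} {r : V → V → Prop} {r' : W → W → Prop}
  {J : PreAbstractSimplicialComplex U} {K : PreAbstractSimplicialComplex V}
  {L : PreAbstractSimplicialComplex W}

/-- The clique complex of the relation `r` on `S`. A singleton is a face only if `r` relates the
point to itself, so points of `S` at which `r` is not reflexive are not vertices. -/
def flagComplex (S : Set V) (r : V → V → Prop) : PreAbstractSimplicialComplex V where
  faces := {s | s.Nonempty ∧ (∀ x ∈ s, x ∈ S) ∧ ∀ x ∈ s, ∀ y ∈ s, r x y}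
  isRelLowerSet_faces := by
    rintro s ⟨hs, hS, hr⟩
    exact ⟨hs, fun u hus hu =>
      ⟨hu, fun x hx => hS x (hus hx), fun x hx y hy => hr x (hus hx) y (hus hy)⟩⟩

theorem Isomorphic.symm (h : Isomorphic K L) : Isomorphic L K := by
  obtain ⟨e, he⟩ := h
  refine ⟨e.symm, fun s => ?_⟩
  have hcancel : (s.map e.symm.toEmbedding).map e.toEmbedding = s := by
    simp [Finset.map_map]
  rw [he, hcancel]

theorem Isomorphic.trans (h : Isomorphic J K) (h' : Isomorphic K L) : Isomorphic J L := by
  obtain ⟨e, he⟩ := h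
  obtain ⟨e', he'⟩ := h'
  refine ⟨e.trans e', fun s => ?_⟩
  rw [he, he', Finset.map_map e.toEmbedding]
  rfl

theorem mem_flagComplex_faces {s : Finset V} : s ∈ (flagComplex S r).faces ↔
    s.Nonempty ∧ (∀ x ∈ s, x ∈ S) ∧ ∀ x ∈ s, ∀ y ∈ s, r x y :=
  Iff.rfl

theorem mem_vertexSet_flagComplex {x : V} : x ∈ vertexSet (flagComplex S r) ↔ x ∈ S ∧ r x x := by
  simp [vertexSet, mem_flagComplex_faces]

theorem map_subtype_mem_flagComplex_faces {s : Finset (vertexSet (flagComplex S r))} :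
    s.map (.subtype _) ∈ (flagComplex S r).faces ↔
      s.Nonempty ∧ ∀ x ∈ s, ∀ y ∈ s, r x y := by
  have hS (x : vertexSet (flagComplex S r)) : x.1 ∈ S := (mem_vertexSet_flagComplex.1 x.2).1
  simp only [mem_flagComplex_faces, Finset.map_nonempty, Finset.forall_mem_map,
    Function.Embedding.subtype_apply, hS, implies_true, true_and]

theorem flagComplex_isomorphic_of_bijOn {f : V → W} (hf : Set.BijOn f S T)
    (hr : ∀ x ∈ S, ∀ y ∈ S, r x y ↔ r' (f x) (f y)) :
    Isomorphic (flagComplex S r) (flagComplex T r') := by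
  have hbij : Set.BijOn f (vertexSet (flagComplex S r)) (vertexSet (flagComplex T r')) := by
    refine ⟨fun x hx => ?_, hf.injOn.mono fun x hx => (mem_vertexSet_flagComplex.1 hx).1,
      fun y hy => ?_⟩
    · rw [mem_vertexSet_flagComplex] at hx ⊢
      exact ⟨hf.mapsTo hx.1, (hr x hx.1 x hx.1).1 hx.2⟩
    · rw [mem_vertexSet_flagComplex] at hy
      obtain ⟨x, hx, rfl⟩ := hf.surjOn hy.1
      exact ⟨x, mem_vertexSet_flagComplex.2 ⟨hx, (hr x hx x hx).2 hy.2⟩, rfl⟩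
  refine ⟨hbij.equiv f, fun s => ?_⟩
  rw [map_subtype_mem_flagComplex_faces, map_subtype_mem_flagComplex_faces, Finset.map_nonempty]
  simp only [Finset.forall_mem_map]
  exact and_congr_right fun _ => forall₂_congr fun x _ => forall₂_congr fun y _ =>
    hr x (mem_vertexSet_flagComplex.1 x.2).1 y (mem_vertexSet_flagComplex.1 y.2).1

theorem link_flagComplex [DecidableEq V] [Std.Symm r] {F : Finset V}
    (hF : F ∈ (flagComplex S r).faces) :
    link (flagComplex S r) F = flagComplex {x ∈ S | ∀ y ∈ F, x ≠ y ∧ r x y} r := by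
  obtain ⟨hne, hFS, hFr⟩ := hF
  ext s
  simp only [link, flagComplex, Set.mem_ofPred_eq, ← Finset.disjoint_iff_inter_eq_empty,
    Finset.mem_union]
  constructor
  · rintro ⟨hs, hd, -, hS, hr⟩
    exact ⟨hs, fun x hx => ⟨hS x (.inr hx), fun y hy =>
      ⟨(Finset.disjoint_left.1 hd.symm hx <| · ▸ hy), hr x (.inr hx) y (.inl hy)⟩⟩,
      fun x hx y hy => hr x (.inr hx) y (.inr hy)⟩
  · rintro ⟨hs, hS, hr⟩
    refine ⟨hs, Finset.disjoint_right.2 fun x hx hxF => ((hS x hx).2 x hxF).1 rfl,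
      hne.mono Finset.subset_union_left, ?_, ?_⟩
    · rintro x (hx | hx)
      exacts [hFS x hx, (hS x hx).1]
    · rintro x (hx | hx) y (hy | hy)
      exacts [hFr x hx y hy, symm ((hS y hy).2 x hx).2, ((hS x hx).2 y hy).2, hr x hx y hy]

end FlagComplexes

section Joins

variable {ι κ : Type*}

theorem join_orderComplex {P : ι → Type*} [∀ i, PartialOrder (P i)] :
    (join fun i => orderComplex (P i)) =
      flagComplex Set.univ fun x y : Σ i, P i => x.1 = y.1 → SymmGen (· ≤ ·) x y := by
  ext t
  simp only [join, orderComplex, flagComplex, Set.mem_ofPred_eq, Set.mem_univ, implies_true,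
    true_and]
  refine and_congr_right fun _ => ⟨?_, fun h i => ?_⟩
  · rintro h ⟨i, x⟩ hx ⟨-, y⟩ hy rfl
    have hx' := Finset.mem_preimage (hf := sigma_mk_injective.injOn).2 hx
    have hy' := Finset.mem_preimage (hf := sigma_mk_injective.injOn).2 hy
    rcases h i with h0 | ⟨-, hchain⟩
    · exact absurd (h0 ▸ hx') (Finset.notMem_empty x)
    · simpa only [SymmGen, Sigma.mk_le_mk_iff] using
        hchain.total (Finset.mem_coe.2 hx') (Finset.mem_coe.2 hy')
  · refine (Finset.eq_empty_or_nonempty _).imp_right fun hne => ⟨hne, fun x hx y hy _ => ?_⟩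
    simpa only [SymmGen, Sigma.mk_le_mk_iff] using
      h ⟨i, x⟩ (Finset.mem_preimage.1 hx) ⟨i, y⟩ (Finset.mem_preimage.1 hy) rfl

theorem join_orderComplex_congr {P : ι → Type*} {Q : κ → Type*} [∀ i, PartialOrder (P i)]
    [∀ j, PartialOrder (Q j)] (e : ι ≃ κ) (f : ∀ i, P i ≃o Q (e i)) :
    Isomorphic (join fun i => orderComplex (P i)) (join fun j => orderComplex (Q j)) := by
  rw [join_orderComplex, join_orderComplex]
  refine flagComplex_isomorphic_of_bijOn (f := Equiv.sigmaCongr e fun i => (f i).toEquiv)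
    (Set.bijOn_univ.2 (Equiv.bijective _)) ?_
  rintro ⟨i, x⟩ - ⟨j, y⟩ -
  refine imp_congr_ctx e.injective.eq_iff.symm fun hij => ?_
  obtain rfl : i = j := e.injective hij
  simp [SymmGen, Equiv.sigmaCongr, Sigma.mk_le_mk_iff]

theorem lt_of_mem_Ioo_of_lt {P : Type*} [Preorder P] {s : ℕ} {d : Fin (s + 1) → P}
    (hd : Monotone d) {i j : Fin s} (hij : i < j) {x y : P}
    (hx : x ∈ Set.Ioo (d i.castSucc) (d i.succ)) (hy : y ∈ Set.Ioo (d j.castSucc) (d j.succ)) :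
    x < y :=
  hx.2.trans_le <| (hd <| Fin.succ_le_castSucc_iff.2 hij).trans hy.1.le

theorem flagComplex_comparable_isomorphic_join {P : Type*} [PartialOrder P] [BoundedOrder P]
    {s : ℕ} {d : Fin (s + 2) → P} (hd : StrictMono d) (h0 : d 0 = ⊥) (h1 : d (Fin.last _) = ⊤) :
    Isomorphic (flagComplex {x | ∀ j, x ≠ d j ∧ SymmGen (· ≤ ·) x (d j)} (SymmGen (· ≤ ·)))
      (join fun i : Fin (s + 1) => orderComplex (Set.Ioo (d i.castSucc) (d i.succ))) := by
  rw [join_orderComplex]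
  refine (flagComplex_isomorphic_of_bijOn (f := fun p => (p.2 : P)) ⟨?_, ?_, ?_⟩ ?_).symm
  · rintro ⟨i, x, hx⟩ - j
    rcases le_or_gt j i.castSucc with hj | hj
    · have hlt : d j < x := (hd.monotone hj).trans_lt hx.1
      exact ⟨hlt.ne', .of_gt hlt⟩
    · have hlt : x < d j := hx.2.trans_le (hd.monotone (Fin.castSucc_lt_iff_succ_le.1 hj))
      exact ⟨hlt.ne, .of_lt hlt⟩
  · rintro ⟨i, x, hx⟩ - ⟨j, y, hy⟩ - (rfl : x = y)
    rcases lt_trichotomy i j with hij | rfl | hij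
    · exact absurd (lt_of_mem_Ioo_of_lt hd.monotone hij hx hy) (lt_irrefl x)
    · rfl
    · exact absurd (lt_of_mem_Ioo_of_lt hd.monotone hij hy hx) (lt_irrefl x)
  · intro x hx
    by_contra hgap
    have hlt (j : Fin (s + 2)) : d j < x := by
      induction j using Fin.induction with
      | zero => exact h0 ▸ bot_lt_iff_ne_bot.2 (h0 ▸ (hx 0).1)
      | succ i ih =>
        rcases (hx i.succ).2 with hle | hle
        · exact absurd ⟨⟨i, x, ih, hle.lt_of_ne (hx i.succ).1⟩, trivial, rfl⟩ hgap
        · exact hle.lt_of_ne' (hx i.succ).1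
    exact not_top_lt (h1 ▸ hlt (Fin.last _))
  · rintro ⟨i, x, hx⟩ - ⟨j, y, hy⟩ -
    rcases lt_trichotomy i j with hij | rfl | hij
    · have := lt_of_mem_Ioo_of_lt hd.monotone hij hx hy
      simp [hij.ne, SymmGen, this.le]
    · simp [SymmGen, Sigma.mk_le_mk_iff]
    · have := lt_of_mem_Ioo_of_lt hd.monotone hij hy hx
      simp [hij.ne', SymmGen, this.le]

end Joins

section Multisets

theorem exists_equiv_of_map_univ_eq {ι κ μ : Type*} [Fintype ι] [Fintype κ] {f : ι → μ} {g : κ → μ}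
    (h : Finset.univ.val.map f = Finset.univ.val.map g) : ∃ e : ι ≃ κ, ∀ i, g (e i) = f i := by
  classical
  have hcard (c : μ) : Fintype.card {i // f i = c} = Fintype.card {j // g j = c} := by
    simpa [Multiset.count_map, Fintype.card_subtype, Finset.card_def, eq_comm] using
      congrArg (Multiset.count c) h
  exact ⟨Equiv.ofFiberEquiv fun c => Fintype.equivOfCardEq (hcard c), Equiv.ofFiberEquiv_map _⟩

theorem exists_toType_equiv_of_map_eq {ι κ μ : Type*} [Fintype ι] [DecidableEq κ] {M : Multiset κ}
    {g : κ → μ} {f : ι → μ} (h : M.map g = Finset.univ.val.map f) :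
    ∃ e : M.ToType ≃ ι, ∀ i, f (e i) = g i.1 :=
  exists_equiv_of_map_univ_eq ((Multiset.map_univ M g).trans h)

end Multisets

section Intervals

variable {P Q : Type*} [PartialOrder P] [PartialOrder Q] [BoundedOrder Q]

theorem nonempty_Ioo_orderIso_of_Icc_orderIso {a b : P} (hab : a ≤ b) (f : Set.Icc a b ≃o Q) :
    Nonempty (Set.Ioo a b ≃o {x : Q // x ≠ ⊥ ∧ x ≠ ⊤}) := by
  have : Fact (a ≤ b) := ⟨hab⟩
  have hmem (x : Set.Icc a b) : x.1 ∈ Set.Ioo a b ↔ f x ≠ ⊥ ∧ f x ≠ ⊤ := by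
    rw [Ne, Ne, map_eq_bot_iff, map_eq_top_iff, ← Ne, ← Ne, ← bot_lt_iff_ne_bot,
      ← lt_top_iff_ne_top]
    rfl
  exact ⟨{
    toFun x := ⟨f ⟨x, Set.Ioo_subset_Icc_self x.2⟩, (hmem _).1 x.2⟩
    invFun y := ⟨(f.symm y).1, (hmem _).2 (by simpa using y.2)⟩
    left_inv x := by simp
    right_inv y := by simp
    map_rel_iff' := by simp }⟩

end Intervals

section FiberUpperSets

variable {α β γ : Type*} [LinearOrder γ] {S A B : Finset α} {c : α → β} {key : α → γ}

/-- `A` is a subset of `S` whose intersection with each fiber of `c` is an upper set of that fiber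
of `S`, ordered by `key`. -/
def IsFiberUpperSet (S : Finset α) (c : α → β) (key : α → γ) (A : Finset α) : Prop :=
  A ⊆ S ∧ ∀ l ∈ A, ∀ m ∈ S, c l = c m → key l < key m → m ∈ A

/-- The subsets of `S` that are upper sets in each fiber of `c`, ordered by inclusion. -/
abbrev FiberUpperSet (S : Finset α) (c : α → β) (key : α → γ) : Type _ :=
  {A : Finset α // IsFiberUpperSet S c key A}

instance : BoundedOrder (FiberUpperSet S c key) where
  bot := ⟨∅, Finset.empty_subset S, by simp⟩
  bot_le A := Finset.empty_subset A.1
  top := ⟨S, Finset.Subset.refl S, fun _ _ m hm _ _ => hm⟩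
  le_top A := A.2.1

theorem FiberUpperSet.coe_bot : ((⊥ : FiberUpperSet S c key) : Finset α) = ∅ := rfl

/-- An interval of fiberwise upper sets consists of the fiberwise upper sets of the difference of
its endpoints. -/
def FiberUpperSet.iccOrderIso [DecidableEq α] {a b : FiberUpperSet S c key} (hab : a ≤ b) :
    Set.Icc a b ≃o FiberUpperSet (b.1 \ a.1) c key where
  toFun A := ⟨A.1.1 \ a.1, Finset.sdiff_subset_sdiff A.2.2 subset_rfl, fun l hl m hm hc hk => by
    rw [Finset.mem_sdiff] at hl hm ⊢
    exact ⟨A.1.2.2 l hl.1 m (b.2.1 hm.1) hc hk, hm.2⟩⟩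
  invFun A := by
    refine ⟨⟨a.1 ∪ A.1, Finset.union_subset a.2.1 (A.2.1.trans (Finset.sdiff_subset.trans b.2.1)),
      fun l hl m hm hc hk => ?_⟩, Finset.subset_union_left,
      Finset.union_subset hab (A.2.1.trans Finset.sdiff_subset)⟩
    by_cases hma : m ∈ a.1
    · exact Finset.mem_union_left _ hma
    · rcases Finset.mem_union.1 hl with hl | hl
      · exact absurd (a.2.2 l hl m hm hc hk) hma
      · have hmb : m ∈ b.1 := b.2.2 l (Finset.mem_sdiff.1 (A.2.1 hl)).1 m hm hc hk
        exact Finset.mem_union_right _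
          (A.2.2 l hl m (Finset.mem_sdiff.2 ⟨hmb, hma⟩) hc hk)
  left_inv A := Subtype.ext (Subtype.ext (Finset.union_sdiff_of_subset A.2.1))
  right_inv A := Subtype.ext <|
    Finset.union_sdiff_cancel_left (Finset.disjoint_of_subset_right A.2.1 Finset.disjoint_sdiff)
  map_rel_iff' {A B} := by
    refine ⟨fun h => ?_, fun h => Finset.sdiff_subset_sdiff h subset_rfl⟩
    have hunion : a.1 ∪ A.1.1 \ a.1 ⊆ a.1 ∪ B.1.1 \ a.1 := Finset.union_subset_union_right h
    rwa [Finset.union_sdiff_of_subset A.2.1, Finset.union_sdiff_of_subset B.2.1] at hunion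

theorem exists_subset_card_eq_of_le_card (key : α → γ) {T : Finset α} {r : ℕ} (hr : r ≤ T.card) :
    ∃ A ⊆ T, A.card = r ∧ ∀ l ∈ A, ∀ m ∈ T, key l < key m → m ∈ A := by
  classical
  induction T using Finset.induction_on_min_value key with
  | empty => exact ⟨∅, by simpa [eq_comm] using hr⟩
  | insert a T ha hmin ih =>
    rcases hr.lt_or_eq with hlt | rfl
    · rw [Finset.card_insert_of_notMem ha, Nat.lt_succ_iff] at hlt
      obtain ⟨A, hAT, hcard, hA⟩ := ih hlt
      refine ⟨A, hAT.trans (Finset.subset_insert a T), hcard, fun l hl m hm hlm => ?_⟩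
      rcases Finset.mem_insert.1 hm with rfl | hm
      · exact absurd hlm (hmin l (hAT hl)).not_gt
      · exact hA l hl m hm hlm
    · exact ⟨insert a T, subset_rfl, rfl, fun _ _ m hm _ => hm⟩

variable [DecidableEq β]

theorem IsFiberUpperSet.subset_of_card_filter_le (hkey : Set.InjOn key S)
    (hA : IsFiberUpperSet S c key A) (hB : IsFiberUpperSet S c key B)
    (h : ∀ l ∈ S, (A.filter (c · = c l)).card ≤ (B.filter (c · = c l)).card) : A ⊆ B := by
  intro l hlA
  by_contra hlB
  refine (h l (hA.1 hlA)).not_gt (Finset.card_lt_card ?_)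
  have hsub : B.filter (c · = c l) ⊆ A.filter (c · = c l) := by
    intro m hm
    obtain ⟨hmB, hml⟩ := Finset.mem_filter.1 hm
    refine Finset.mem_filter.2 ⟨?_, hml⟩
    rcases lt_trichotomy (key l) (key m) with hlt | heq | hgt
    · exact hA.2 l hlA m (hB.1 hmB) hml.symm hlt
    · exact hkey (hA.1 hlA) (hB.1 hmB) heq ▸ hlA
    · exact absurd (hB.2 m hmB l (hA.1 hlA) hml hgt) hlB
  exact (Finset.ssubset_iff_of_subset hsub).2 ⟨l, by simp [hlA], by simp [hlB]⟩

theorem exists_isFiberUpperSet_card_filter_eq (key : α → γ) {r : β → ℕ}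
    (hr : ∀ b, r b ≤ (S.filter (c · = b)).card) :
    ∃ A, IsFiberUpperSet S c key A ∧ ∀ b, (A.filter (c · = b)).card = r b := by
  classical
  choose T hTS hcard hT using fun b => exists_subset_card_eq_of_le_card key (hr b)
  have hTb {b : β} {l : α} (hl : l ∈ T b) : l ∈ S ∧ c l = b := Finset.mem_filter.1 (hTS b hl)
  refine ⟨S.filter fun l => l ∈ T (c l), ⟨Finset.filter_subset _ _, ?_⟩, fun b => ?_⟩
  · intro l hl m hm hlm hk
    have hl' := (Finset.mem_filter.1 hl).2
    exact Finset.mem_filter.2 ⟨hm, hT (c m) l (hlm ▸ hl') m (by simp [hm]) hk⟩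
  · rw [← hcard b]
    congr 1
    ext l
    simp only [Finset.mem_filter]
    exact ⟨fun ⟨⟨_, hl⟩, hlb⟩ => hlb ▸ hl,
      fun hl => ⟨⟨(hTb hl).1, (hTb hl).2.symm ▸ hl⟩, (hTb hl).2⟩⟩

/-- The sizes of the nonempty fibers of `c` on `S`. -/
def fiberCards (S : Finset α) (c : α → β) : Multiset ℕ :=
  (S.image c).val.map fun b => (S.filter (c · = b)).card

theorem fiberCards_congr {c' : α → β} (h : Set.EqOn c c' S) : fiberCards S c = fiberCards S c' := by
  rw [fiberCards, fiberCards, Finset.image_congr h]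
  exact Multiset.map_congr rfl fun b _ =>
    congrArg Finset.card (Finset.filter_congr fun l hl => by rw [h hl])

theorem sum_fiberCards (S : Finset α) (c : α → β) : (fiberCards S c).sum = S.card :=
  (Finset.card_eq_sum_card_image c S).symm

theorem pos_of_mem_fiberCards {r : ℕ} (hr : r ∈ fiberCards S c) : 0 < r := by
  obtain ⟨b, hb, rfl⟩ := Multiset.mem_map.1 hr
  obtain ⟨l, hl, rfl⟩ := Finset.mem_image.1 hb
  exact Finset.card_pos.2 ⟨l, by simp [hl]⟩

/-- An upper set in a chain is determined by its size, which is arbitrary. -/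
theorem nonempty_fiberUpperSet_orderIso_chainProduct (hkey : Set.InjOn key S) :
    Nonempty (FiberUpperSet S c key ≃o ChainProduct (fiberCards S c)) := by
  have hmap : (fiberCards S c).map id =
      Finset.univ.val.map fun b : S.image c => (S.filter (c · = b.1)).card := by
    rw [Multiset.map_id]
    exact (Multiset.attach_map_val' _ _).symm
  obtain ⟨e, he⟩ := exists_toType_equiv_of_map_eq hmap
  have hlt (A : FiberUpperSet S c key) (i) : (A.1.filter (c · = (e i).1)).card < i.1 + 1 :=
    Nat.lt_succ_of_le <|
      (Finset.card_le_card (Finset.filter_subset_filter _ A.2.1)).trans (he i).le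
  let count : FiberUpperSet S c key ↪o ChainProduct (fiberCards S c) :=
    OrderEmbedding.ofMapLEIff (fun A i => ⟨_, hlt A i⟩) fun A B => by
      refine ⟨fun h => A.2.subset_of_card_filter_le hkey B.2 fun l hl => ?_, fun h i =>
        Finset.card_le_card (Finset.filter_subset_filter _ h)⟩
      simpa using h (e.symm ⟨c l, Finset.mem_image_of_mem c hl⟩)
  refine ⟨RelIso.ofSurjective count fun x => ?_⟩
  let r (b : β) : ℕ := if hb : b ∈ S.image c then x (e.symm ⟨b, hb⟩) else 0
  have hr (b : β) : r b ≤ (S.filter (c · = b)).card := by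
    unfold r
    split_ifs with hb
    · exact (x (e.symm ⟨b, hb⟩)).is_le.trans (by simpa using (he (e.symm ⟨b, hb⟩)).ge)
    · exact Nat.zero_le _
  obtain ⟨A, hA, hcard⟩ := exists_isFiberUpperSet_card_filter_eq key hr
  refine ⟨⟨A, hA⟩, funext fun i => Fin.ext <| (hcard (e i).1).trans ?_⟩
  simp only [r, dif_pos (e i).2]
  rw [Subtype.coe_eta, e.symm_apply_apply]

end FiberUpperSets

section EdgewiseFlag

variable {n q : ℕ}

/-- Two integer points are adjacent if they are comparable and lie in a common unit cube. -/
abbrev Adjacent {ι : Type*} : (ι → ℤ) → (ι → ℤ) → Prop :=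
  SymmGen fun u w => u ≤ w ∧ w ≤ u + 1

theorem facetVertex_apply (v : Fin n → ℤ) (π : Equiv.Perm (Fin n)) (m : Fin (n + 1)) (l : Fin n) :
    facetVertex v π m l = v l + if n ≤ (π.symm l : ℕ) + m then 1 else 0 := by
  have hsingle (j : Fin n) : (Pi.single (π j) (1 : ℤ) : Fin n → ℤ) l =
      if π.symm l = j then 1 else 0 := by
    simp only [Pi.single_apply, Equiv.symm_apply_eq]
  simp only [facetVertex, Pi.add_apply, Finset.sum_apply, hsingle, Finset.sum_ite_eq,
    Finset.mem_filter, Finset.mem_univ, true_and]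

theorem mem_facet {v w : Fin n → ℤ} {π : Equiv.Perm (Fin n)} :
    w ∈ facet v π ↔ ∃ m, facetVertex v π m = w := by
  simp [facet]

theorem adjacent_of_mem_facet {v u w : Fin n → ℤ} {π : Equiv.Perm (Fin n)} (hu : u ∈ facet v π)
    (hw : w ∈ facet v π) : Adjacent u w := by
  obtain ⟨a, rfl⟩ := mem_facet.1 hu
  obtain ⟨b, rfl⟩ := mem_facet.1 hw
  wlog hab : a ≤ b
  · exact (this _ hw _ hu (le_of_not_ge hab)).symm
  rw [Fin.le_def] at hab
  left
  constructor <;> intro l <;> simp only [Pi.add_apply, Pi.one_apply, facetVertex_apply] <;>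
    split_ifs <;> omega

theorem mem_facet_iff_monotone {v w : Fin n → ℤ} {π : Equiv.Perm (Fin n)} :
    w ∈ facet v π ↔ v ≤ w ∧ w ≤ v + 1 ∧ Monotone ((w - v) ∘ π) := by
  rw [mem_facet]
  constructor
  · rintro ⟨m, rfl⟩
    refine ⟨Pi.le_def.2 fun l => ?_, Pi.le_def.2 fun l => ?_, fun i j hij => ?_⟩
    · rw [facetVertex_apply]
      split_ifs <;> omega
    · rw [facetVertex_apply, Pi.add_apply, Pi.one_apply]
      split_ifs <;> omega
    · rw [Fin.le_def] at hij
      simp only [Function.comp_apply, Pi.sub_apply, facetVertex_apply, Equiv.symm_apply_apply]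
      split_ifs <;> omega
  · rintro ⟨hvw, hwv, hmono⟩
    obtain ⟨z, hz⟩ : ∃ z : ℕ, ∀ l, (π.symm l : ℕ) < z ↔ w l - v l ≤ 0 :=
      ⟨_, fun l =>
        (Tuple.lt_card_le_iff_apply_le_of_monotone hmono (a := 0)).trans (by simp)⟩
    refine ⟨⟨n - z, by omega⟩, funext fun l => ?_⟩
    have hl : v l ≤ w l := hvw l
    have hl' : w l ≤ v l + 1 := hwv l
    have := hz l
    rw [facetVertex_apply]
    dsimp only
    split_ifs <;> omega

theorem Consistent.symm_lt_symm {v : Fin n → ℤ} {π : Equiv.Perm (Fin n)} (hπ : Consistent v π)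
    (hv : Monotone v) {i j : Fin n} (hij : i < j) (h : v i = v j) : π.symm i < π.symm j := by
  obtain ⟨j, hj⟩ := j
  induction j with
  | zero => exact absurd hij (Nat.not_lt_zero _)
  | succ m ih =>
    have hm : m < n := by omega
    rcases (Nat.lt_succ_iff.1 hij).eq_or_lt with him | him
    · exact hπ _ _ (congrArg (· + 1) him.symm) h
    · have hle : v i ≤ v ⟨m, hm⟩ := hv him.le
      have hle' : v ⟨m, hm⟩ ≤ v ⟨m + 1, hj⟩ := hv (Nat.le_succ m)
      exact (ih hm him (hle.antisymm (h ▸ hle'))).trans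
        (hπ _ _ rfl (hle'.antisymm (h ▸ hle)))

theorem mem_latticePoints_of_mem_facet {v w : Fin n → ℤ} {π : Equiv.Perm (Fin n)}
    (hv : v ∈ latticePoints n q) (hv1 : v + 1 ∈ latticePoints n q) (hπ : Consistent v π)
    (hw : w ∈ facet v π) : w ∈ latticePoints n q := by
  obtain ⟨hvw, hwv, hmono⟩ := mem_facet_iff_monotone.1 hw
  refine ⟨fun i j hij => ?_, fun i => ⟨(hv.2 i).1.trans (hvw i), (hwv i).trans (hv1.2 i).2⟩⟩
  rcases (hv.1 hij).lt_or_eq with hlt | heq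
  · exact (hwv i).trans ((Int.add_one_le_iff.2 hlt).trans (hvw j))
  · rcases hij.eq_or_lt with rfl | hij
    · exact le_rfl
    · have := hmono (hπ.symm_lt_symm hv.1 hij heq).le
      simp only [Function.comp_apply, Equiv.apply_symm_apply, Pi.sub_apply] at this
      omega

theorem sub_le_sub_of_sum_sub_le_sum_sub {ι : Type*} {s : Finset (ι → ℤ)} {b : ι → ℤ}
    (hs : ∀ w ∈ s, b ≤ w ∧ w ≤ b + 1) (hchain : IsChain (· ≤ ·) (s : Set (ι → ℤ))) {i j : ι}
    (hij : ∑ w ∈ s, (w i - b i) ≤ ∑ w ∈ s, (w j - b j)) {w : ι → ℤ} (hw : w ∈ s) :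
    w i - b i ≤ w j - b j := by
  have hcube {u : ι → ℤ} (hu : u ∈ s) (l : ι) : b l ≤ u l ∧ u l ≤ b l + 1 :=
    ⟨(hs u hu).1 l, (hs u hu).2 l⟩
  have hwi := hcube hw i
  have hwj := hcube hw j
  by_contra! hlt
  refine hij.not_gt (Finset.sum_lt_sum (fun u hu => ?_) ⟨w, hw, hlt⟩)
  have hui := hcube hu i
  have huj := hcube hu j
  rcases hchain.total hu hw with hle | hle
  · have : u i ≤ w i := hle i
    have : u j ≤ w j := hle j
    omega
  · have : w i ≤ u i := hle i
    have : w j ≤ u j := hle j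
    omega

theorem exists_consistent_subset_facet {s : Finset (Fin n → ℤ)} {b : Fin n → ℤ}
    (hmono : ∀ w ∈ s, Monotone w) (hs : ∀ w ∈ s, b ≤ w ∧ w ≤ b + 1)
    (hchain : IsChain (· ≤ ·) (s : Set (Fin n → ℤ))) :
    ∃ π : Equiv.Perm (Fin n), Consistent b π ∧ s ⊆ facet b π := by
  -- Sorting must be stable for `π` to be consistent with `b`.
  let f (i : Fin n) : ℤ := ∑ w ∈ s, (w i - b i)
  obtain ⟨hsort, hstable⟩ := Tuple.eq_sort_iff.1 (rfl : Tuple.sort f = Tuple.sort f)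
  refine ⟨Tuple.sort f, fun i j hij hb => ?_, fun w hw => mem_facet_iff_monotone.2
    ⟨(hs w hw).1, (hs w hw).2, fun i j hij =>
      sub_le_sub_of_sum_sub_le_sum_sub hs hchain (hsort hij) hw⟩⟩
  have hlt : i < j := Fin.lt_def.2 (by omega)
  have hf : f i ≤ f j := Finset.sum_le_sum fun w hw => by
    rw [hb]
    exact sub_le_sub_right (hmono w hw hlt.le) _
  by_contra! hle
  have hne : (Tuple.sort f).symm j ≠ (Tuple.sort f).symm i := by simp [hlt.ne']
  have hge := hsort hle
  have hinv := hstable _ _ (hle.lt_of_ne hne)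
  simp only [Function.comp_apply, Equiv.apply_symm_apply] at hge hinv
  exact (hinv (hge.antisymm hf)).asymm hlt

theorem isChain_of_forall_adjacent {ι : Type*} {s : Finset (ι → ℤ)}
    (hadj : ∀ u ∈ s, ∀ w ∈ s, Adjacent u w) : IsChain (· ≤ ·) (s : Set (ι → ℤ)) :=
  fun u hu w hw _ => (hadj u hu w hw).imp And.left And.left

theorem Adjacent.le_add_one {ι : Type*} {u w : ι → ℤ} (h : Adjacent u w) : w ≤ u + 1 :=
  h.elim And.right fun h => h.1.trans (le_add_of_nonneg_right zero_le_one)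

theorem exists_unit_cube_of_forall_adjacent (hq : 1 ≤ q) {s : Finset (Fin n → ℤ)}
    (hne : s.Nonempty) (hL : ∀ w ∈ s, w ∈ latticePoints n q)
    (hadj : ∀ u ∈ s, ∀ w ∈ s, Adjacent u w) :
    ∃ b ∈ latticePoints n q, b + 1 ∈ latticePoints n q ∧ ∀ w ∈ s, b ≤ w ∧ w ≤ b + 1 := by
  obtain ⟨M, hM, hmax⟩ := s.exists_maximal hne
  have hle (w) (hw : w ∈ s) : w ≤ M :=
    ((isChain_of_forall_adjacent hadj).total hw hM).elim id (hmax hw)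
  -- The least point of `s` would not do: its coordinates equal to `q` cannot be raised.
  let b : Fin n → ℤ := fun l => max (M l - 1) 0
  have hb : b ∈ latticePoints n q := by
    refine ⟨fun i j hij => max_le_max (sub_le_sub_right ((hL M hM).1 hij) 1) le_rfl, fun i => ?_⟩
    have := (hL M hM).2 i
    grind
  have hb1 : b + 1 ∈ latticePoints n q := by
    refine ⟨fun i j hij => add_le_add_left (hb.1 hij) 1, fun i => ?_⟩
    have := (hL M hM).2 i
    simp only [b, Pi.add_apply, Pi.one_apply]
    omega
  refine ⟨b, hb, hb1, fun w hw => ⟨fun l => max_le ?_ ((hL w hw).2 l).1,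
    fun l => (hle w hw l).trans ?_⟩⟩
  · exact sub_le_iff_le_add.2 ((hadj w hw M hM).le_add_one l)
  · simp only [b, Pi.add_apply, Pi.one_apply]
    omega

theorem edgewise_eq_flagComplex (hq : 1 ≤ q) :
    edgewise n q = flagComplex (latticePoints n q) Adjacent := by
  ext s
  refine and_congr_right fun hne => ⟨?_, fun ⟨hL, hadj⟩ => ?_⟩
  · rintro ⟨v, π, -, -, hL, hsub⟩
    exact ⟨fun w hw => hL w (hsub hw), fun u hu w hw => adjacent_of_mem_facet (hsub hu) (hsub hw)⟩
  · obtain ⟨b, hb, hb1, hcube⟩ := exists_unit_cube_of_forall_adjacent hq hne hL hadj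
    obtain ⟨π, hπ, hsub⟩ := exists_consistent_subset_facet (fun w hw => (hL w hw).1) hcube
      (isChain_of_forall_adjacent hadj)
    exact ⟨b, π, hb, hπ, fun w => mem_latticePoints_of_mem_facet hb hb1 hπ, hsub⟩

end EdgewiseFlag

section Shift

variable {n q : ℕ}

/-- The point `w` with the coordinate `0` appended at the index `k`. -/
def appendZero (w : Fin n → ℤ) : Fin (n + 1) → ℤ :=
  Fin.snoc (α := fun _ => ℤ) w 0

@[simp] theorem appendZero_castSucc (w : Fin n → ℤ) (l : Fin n) :
    appendZero w l.castSucc = w l := by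
  simp [appendZero]

@[simp] theorem appendZero_last (w : Fin n → ℤ) : appendZero w (Fin.last n) = 0 := by
  simp [appendZero]

/-- The condition on the right treats `k` like the other indices and is unchanged when a constant is
added to all coordinates; this makes `shift` manageable. -/
theorem adjacent_iff_sub_sub_le_one {u w : Fin n → ℤ} :
    Adjacent u w ↔ ∀ i j,
      (appendZero w i - appendZero u i) - (appendZero w j - appendZero u j) ≤ 1 := by
  simp only [Adjacent, SymmGen, Pi.le_def, Pi.add_apply, Pi.one_apply, Fin.forall_fin_succ',
    appendZero_castSucc, appendZero_last]
  constructor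
  · rintro (⟨h, h'⟩ | ⟨h, h'⟩) <;>
      refine ⟨fun i => ⟨fun j => ?_, ?_⟩, fun j => ?_, ?_⟩ <;> grind
  · rintro ⟨h, h0, -⟩
    by_cases hle : ∀ l, u l ≤ w l
    · exact Or.inl ⟨hle, fun l => by have := (h l).2; omega⟩
    · obtain ⟨m, hm⟩ := not_forall.1 hle
      exact Or.inr ⟨fun l => by have := (h l).1 m; omega, fun l => by have := h0 l; omega⟩

/-- The point `w` with the coordinates named by `A` increased by one, where the coordinate of index
`k` is an appended `0`, to which it is brought back by subtracting a constant from all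
coordinates. -/
def shift (w : Fin n → ℤ) (A : Finset (Fin (n + 1))) : Fin n → ℤ := fun l =>
  w l + (if l.castSucc ∈ A then 1 else 0) - (if Fin.last n ∈ A then 1 else 0)

theorem appendZero_shift (w : Fin n → ℤ) (A : Finset (Fin (n + 1))) (i : Fin (n + 1)) :
    appendZero (shift w A) i =
      appendZero w i + (if i ∈ A then 1 else 0) - (if Fin.last n ∈ A then 1 else 0) := by
  induction i using Fin.lastCases with
  | last => simp
  | cast l => simp [shift]

theorem adjacent_shift_iff {w : Fin n → ℤ} {B C : Finset (Fin (n + 1))} :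
    Adjacent (shift w B) (shift w C) ↔ SymmGen (· ≤ ·) B C := by
  rw [adjacent_iff_sub_sub_le_one]
  simp only [appendZero_shift]
  constructor
  · intro h
    by_contra! hBC
    obtain ⟨⟨x, hxB, hxC⟩, y, hyC, hyB⟩ :=
      (not_or.1 hBC).imp Finset.not_subset.1 Finset.not_subset.1
    have := h y x
    simp only [hxB, hxC, hyB, hyC, if_true, if_false] at this
    omega
  · rintro (h | h) i j <;> have hi := @h i <;> have hj := @h j <;> split_ifs <;>
      first | omega | tauto

theorem subset_of_shift_eq_shift {w : Fin n → ℤ} {B C : Finset (Fin (n + 1))}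
    (hB : B ≠ Finset.univ) (h : shift w B = shift w C) : B ⊆ C := by
  intro x hxB
  by_contra hxC
  refine hB (Finset.eq_univ_iff_forall.2 fun y => by_contra fun hyB => ?_)
  have hx := congrFun (congrArg appendZero h) x
  have hy := congrFun (congrArg appendZero h) y
  simp only [appendZero_shift, hxB, hxC, hyB, if_true, if_false] at hx hy
  split_ifs at hx hy <;> omega

theorem injOn_shift (w : Fin n → ℤ) : Set.InjOn (shift w) {B | B ≠ Finset.univ} :=
  fun _ hB _ hC h => (subset_of_shift_eq_shift hB h).antisymm (subset_of_shift_eq_shift hC h.symm)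

theorem shift_empty (w : Fin n → ℤ) : shift w ∅ = w := by
  funext l
  simp [shift]

theorem exists_shift_eq_of_adjacent {u w : Fin n → ℤ} (h : Adjacent u w) :
    ∃ B ≠ Finset.univ, shift u B = w := by
  let D (i : Fin (n + 1)) : ℤ := appendZero w i - appendZero u i
  have hD (i j) : D i - D j ≤ 1 := adjacent_iff_sub_sub_le_one.1 h i j
  obtain ⟨a, ha⟩ := Finite.exists_min D
  refine ⟨Finset.univ.filter fun i => D a < D i, fun huniv => ?_, funext fun l => ?_⟩
  · simpa using huniv.ge (Finset.mem_univ a)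
  · have hDl : D l.castSucc = w l - u l := by simp [D]
    have hDk : D (Fin.last n) = 0 := by simp [D]
    have := ha l.castSucc
    have := ha (Fin.last n)
    have := hD l.castSucc a
    have := hD (Fin.last n) a
    simp only [shift, Finset.mem_filter, Finset.mem_univ, true_and]
    split_ifs <;> omega

theorem chainLabel_eq_ite (w : Fin n → ℤ) (i : Fin (n + 1)) :
    chainLabel q w i = if appendZero w i = q then 0 else appendZero w i := by
  induction i using Fin.lastCases <;> simp [chainLabel]

/-- The position of an index in a cyclic order on the indices, listed so that in the class of `k`
the indices of coordinates `q` come before `k` and those of coordinates `0` after it. -/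
def cyclicKey (w : Fin n → ℤ) : Fin (n + 1) → ℕ :=
  Fin.snoc (α := fun _ => ℕ) (fun l => if w l = 0 then l + (n + 1) else l) n

theorem cyclicKey_castSucc (w : Fin n → ℤ) (l : Fin n) :
    cyclicKey w l.castSucc = if w l = 0 then l + (n + 1) else (l : ℕ) := by
  simp [cyclicKey]

theorem cyclicKey_last (w : Fin n → ℤ) : cyclicKey w (Fin.last n) = n := by
  simp [cyclicKey]

theorem cyclicKey_injective (w : Fin n → ℤ) : Function.Injective (cyclicKey w) := by
  have hmod (i : Fin (n + 1)) : cyclicKey w i % (n + 1) = i := by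
    induction i using Fin.lastCases with
    | last => simp [cyclicKey_last]
    | cast l =>
      rw [cyclicKey_castSucc, Fin.val_castSucc]
      split_ifs
      · rw [Nat.add_mod_right, Nat.mod_eq_of_lt (by omega)]
      · rw [Nat.mod_eq_of_lt (by omega)]
  exact fun i j h => Fin.ext (by rw [← hmod i, h, hmod j])

theorem shift_mem_latticePoints_iff {w : Fin n → ℤ} (hw : w ∈ latticePoints n q)
    {A : Finset (Fin (n + 1))} :
    shift w A ∈ latticePoints n q ↔
      (∀ i j, i < j → w i = w j → i.castSucc ∈ A → j.castSucc ∈ A) ∧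
      (∀ i, w i = 0 → Fin.last n ∈ A → i.castSucc ∈ A) ∧
      ∀ i, w i = q → i.castSucc ∈ A → Fin.last n ∈ A := by
  constructor
  · rintro ⟨hmono, hbound⟩
    refine ⟨fun i j hij heq hi => by_contra fun hj => ?_, fun i heq hk => by_contra fun hi => ?_,
      fun i heq hi => by_contra fun hk => ?_⟩
    · have := hmono hij.le
      simp only [shift, hi, hj, if_true, if_false] at this
      omega
    · have := hbound i
      simp only [shift, hi, hk, if_true, if_false] at this
      omega
    · have := hbound i
      simp only [shift, hi, hk, if_true, if_false] at this
      omega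
  · rintro ⟨hclass, hzero, htop⟩
    refine ⟨monotone_iff_forall_lt.2 fun i j hij => ?_, fun i => ?_⟩
    · have := hw.1 hij.le
      have := hclass i j hij
      simp only [shift]
      grind
    · have := hw.2 i
      have := hzero i
      have := htop i
      simp only [shift]
      grind

theorem shift_mem_latticePoints_iff_isFiberUpperSet (hq : 1 ≤ q) {w : Fin n → ℤ}
    (hw : w ∈ latticePoints n q) {A : Finset (Fin (n + 1))} :
    shift w A ∈ latticePoints n q ↔
      IsFiberUpperSet Finset.univ (chainLabel q w) (cyclicKey w) A := by
  rw [shift_mem_latticePoints_iff hw]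
  simp only [IsFiberUpperSet, Finset.subset_univ, Finset.mem_univ, true_and, true_imp_iff,
    Fin.forall_fin_succ', chainLabel_eq_ite, appendZero_castSucc, appendZero_last, ite_self,
    cyclicKey_castSucc, cyclicKey_last]
  constructor
  · rintro ⟨hclass, hzero, htop⟩
    have (i j : Fin n) (h : w i < w j) : i < j := hw.1.reflect_lt h
    refine ⟨fun i hi => ⟨fun j => ?_, ?_⟩, fun hk => ⟨fun j => ?_, ?_⟩⟩ <;> grind
  · intro ⟨h, hk⟩
    refine ⟨fun i j hij heq hi => ?_, fun i heq hl => ?_, fun i heq hi => ?_⟩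
    · exact (h i hi).1 j (by rw [heq]) (by grind)
    · exact (hk hl).1 i (by grind) (by grind)
    · exact (h i hi).2 (by grind) (by grind)

theorem bijOn_shift (hq : 1 ≤ q) {w : Fin n → ℤ} (hw : w ∈ latticePoints n q) :
    Set.BijOn (fun A : FiberUpperSet Finset.univ (chainLabel q w) (cyclicKey w) => shift w A.1)
      {A | A ≠ ⊤} {x | x ∈ latticePoints n q ∧ Adjacent w x} := by
  have hne {A : FiberUpperSet Finset.univ (chainLabel q w) (cyclicKey w)} :
      A ≠ ⊤ ↔ A.1 ≠ Finset.univ := Subtype.ext_iff.not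
  refine ⟨fun A _ => ⟨(shift_mem_latticePoints_iff_isFiberUpperSet hq hw).2 A.2, ?_⟩,
    fun A hA B hB h => Subtype.ext (injOn_shift w (hne.1 hA) (hne.1 hB) h), ?_⟩
  · conv => left; rw [← shift_empty w]
    exact adjacent_shift_iff.2 (Or.inl (Finset.empty_subset A.1))
  · rintro x ⟨hx, hadj⟩
    obtain ⟨B, hB, rfl⟩ := exists_shift_eq_of_adjacent hadj
    exact ⟨⟨B, (shift_mem_latticePoints_iff_isFiberUpperSet hq hw).1 hx⟩, hne.2 hB, rfl⟩

theorem bijOn_shift_comparable (hq : 1 ≤ q) {w : Fin n → ℤ} (hw : w ∈ latticePoints n q) {s : ℕ}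
    {d : Fin (s + 2) → FiberUpperSet Finset.univ (chainLabel q w) (cyclicKey w)}
    (hd : StrictMono d) (h0 : d 0 = ⊥) (h1 : d (Fin.last (s + 1)) = ⊤) :
    Set.BijOn (fun A : FiberUpperSet Finset.univ (chainLabel q w) (cyclicKey w) => shift w A.1)
      {A | ∀ j, A ≠ d j ∧ SymmGen (· ≤ ·) A (d j)}
      {x | x ∈ latticePoints n q ∧ ∀ i : Fin (s + 1),
        x ≠ shift w (d i.castSucc).1 ∧ Adjacent x (shift w (d i.castSucc).1)} := by
  have hbij := bijOn_shift hq hw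
  have hsub : {x | x ∈ latticePoints n q ∧ ∀ i : Fin (s + 1),
      x ≠ shift w (d i.castSucc).1 ∧ Adjacent x (shift w (d i.castSucc).1)} ⊆
      {x | x ∈ latticePoints n q ∧ Adjacent w x} := fun x hx => by
    have hadj := (hx.2 0).2.symm
    rw [Fin.castSucc_zero, h0] at hadj
    exact ⟨hx.1, shift_empty w ▸ hadj⟩
  convert hbij.subset_right hsub using 1
  ext A
  have htop : SymmGen (· ≤ ·) A (d (Fin.last (s + 1))) := Or.inl (h1 ▸ le_top)
  have hcut (i : Fin (s + 1)) : d i.castSucc ≠ ⊤ := h1 ▸ (hd i.castSucc_lt_last).ne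
  have hmem (hA : A ≠ ⊤) (i : Fin (s + 1)) : (shift w A.1 ≠ shift w (d i.castSucc).1 ∧
      Adjacent (shift w A.1) (shift w (d i.castSucc).1)) ↔
        A ≠ d i.castSucc ∧ SymmGen (· ≤ ·) A (d i.castSucc) :=
    and_congr (hbij.injOn.ne_iff hA (hcut i)) adjacent_shift_iff
  constructor
  · intro h
    have hA : A ≠ ⊤ := h1 ▸ (h (Fin.last _)).1
    exact ⟨hA, (hbij.mapsTo hA).1, fun i => (hmem hA i).2 (h i.castSucc)⟩
  · rintro ⟨hA, -, h⟩
    exact Fin.lastCases ⟨h1 ▸ hA, htop⟩ fun i => (hmem hA i).1 (h i)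

theorem link_isomorphic_join_Ioo (hq : 1 ≤ q) {w : Fin n → ℤ} {s : ℕ}
    {d : Fin (s + 2) → FiberUpperSet Finset.univ (chainLabel q w) (cyclicKey w)}
    (hd : StrictMono d) (h0 : d 0 = ⊥) (h1 : d (Fin.last (s + 1)) = ⊤)
    (hF : Finset.univ.image (fun i : Fin (s + 1) => shift w (d i.castSucc).1) ∈
      (edgewise n q).faces) :
    Isomorphic
      (link (edgewise n q) (Finset.univ.image fun i : Fin (s + 1) => shift w (d i.castSucc).1))
      (join fun i : Fin (s + 1) => orderComplex (Set.Ioo (d i.castSucc) (d i.succ))) := by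
  rw [edgewise_eq_flagComplex hq] at hF ⊢
  have hw : w ∈ latticePoints n q := by
    have := hF.2.1 _ (Finset.mem_image_of_mem _ (Finset.mem_univ 0))
    rwa [Fin.castSucc_zero, h0, FiberUpperSet.coe_bot, shift_empty] at this
  rw [link_flagComplex hF]
  simp only [Finset.forall_mem_image, Finset.mem_univ, true_imp_iff]
  exact (flagComplex_isomorphic_of_bijOn (bijOn_shift_comparable hq hw hd h0 h1)
    fun A _ B _ => adjacent_shift_iff.symm).symm.trans
      (flagComplex_comparable_isomorphic_join hd h0 h1)

end Shift

section CutSets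

variable {n q s : ℕ} {u w x : Fin n → ℤ} {v : Fin (s + 1) → Fin n → ℤ}

theorem appendZero_le_appendZero (h : u ≤ w) : appendZero u ≤ appendZero w := by
  simpa only [Pi.le_def, Fin.forall_fin_succ', appendZero_castSucc, appendZero_last, le_refl,
    and_true] using h

theorem appendZero_le_appendZero_add_one (h : w ≤ u + 1) : appendZero w ≤ appendZero u + 1 := by
  simpa [Pi.le_def, Fin.forall_fin_succ'] using h

/-- The indices of the coordinates in which `u` and `w` differ; `k` is not one of them. -/
def differSet (u w : Fin n → ℤ) : Finset (Fin (n + 1)) :=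
  Finset.univ.filter fun i => appendZero u i ≠ appendZero w i

theorem mem_differSet {i : Fin (n + 1)} :
    i ∈ differSet u w ↔ appendZero u i ≠ appendZero w i := by
  simp [differSet]

theorem last_notMem_differSet : Fin.last n ∉ differSet u w := by
  simp [mem_differSet]

theorem stepSet_eq_differSet (v : Fin (s + 1) → Fin n → ℤ) (i : Fin s) :
    stepSet v i = differSet (v i.castSucc) (v i.succ) := by
  ext l
  induction l using Fin.lastCases <;> simp [stepSet, mem_differSet]

theorem shift_differSet (huw : u ≤ w) (hwu : w ≤ u + 1) : shift u (differSet u w) = w := by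
  funext l
  have hle : u l ≤ w l := huw l
  have hle' : w l ≤ u l + 1 := hwu l
  simp only [shift, mem_differSet, appendZero_castSucc, appendZero_last]
  split_ifs <;> omega

theorem differSet_subset_differSet (huw : u ≤ w) (hwx : w ≤ x) :
    differSet u w ⊆ differSet u x := by
  intro i hi
  rw [mem_differSet] at hi ⊢
  exact ((appendZero_le_appendZero huw i).lt_of_ne hi |>.trans_le
    (appendZero_le_appendZero hwx i)).ne

theorem differSet_sdiff_differSet (huw : u ≤ w) (hwx : w ≤ x) (hxu : x ≤ u + 1) :
    differSet u x \ differSet u w = differSet w x := by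
  ext i
  have huwi : appendZero u i ≤ appendZero w i := appendZero_le_appendZero huw i
  have hwxi : appendZero w i ≤ appendZero x i := appendZero_le_appendZero hwx i
  have hxui : appendZero x i ≤ appendZero u i + 1 := appendZero_le_appendZero_add_one hxu i
  simp only [Finset.mem_sdiff, mem_differSet]
  omega

theorem biUnion_stepSet (hv : Monotone v) :
    Finset.univ.biUnion (stepSet v) = differSet (v 0) (v (Fin.last s)) := by
  ext l
  have hmono : Monotone fun i => appendZero (v i) l :=
    fun i j hij => appendZero_le_appendZero (hv hij) l
  simp only [Finset.mem_biUnion, Finset.mem_univ, true_and, stepSet_eq_differSet, mem_differSet]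
  rw [← not_iff_not]
  push Not
  constructor
  · intro h
    have hanti : Antitone fun i => appendZero (v i) l :=
      Fin.antitone_iff_succ_le.2 fun i => (h i).ge
    exact (hmono (Fin.zero_le _)).antisymm (hanti (Fin.zero_le _))
  · intro h i
    exact (hmono i.castSucc_lt_succ.le).antisymm
      ((hmono (Fin.le_last _)).trans (h.ge.trans (hmono (Fin.zero_le _))))

/-- The sets `∅ ⊂ S_1 ⊂ S_1 ∪ S_2 ⊂ ⋯ ⊂ S_1 ∪ ⋯ ∪ S_t = {1, …, k}` of a chain of points: those
before the last consist of the indices of the coordinates raised since the least point. -/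
def cutSet (v : Fin (s + 1) → Fin n → ℤ) : Fin (s + 2) → Finset (Fin (n + 1)) :=
  Fin.snoc (α := fun _ => Finset (Fin (n + 1))) (fun i => differSet (v 0) (v i)) Finset.univ

@[simp] theorem cutSet_castSucc (v : Fin (s + 1) → Fin n → ℤ) (i : Fin (s + 1)) :
    cutSet v i.castSucc = differSet (v 0) (v i) := by
  simp [cutSet]

@[simp] theorem cutSet_last (v : Fin (s + 1) → Fin n → ℤ) :
    cutSet v (Fin.last (s + 1)) = Finset.univ := by
  simp [cutSet]

theorem cutSet_zero (v : Fin (s + 1) → Fin n → ℤ) : cutSet v 0 = ∅ := by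
  rw [← Fin.castSucc_zero, cutSet_castSucc]
  simp [differSet]

theorem strictMono_cutSet (hv : StrictMono v) (hcube : ∀ i, v i ≤ v 0 + 1) :
    StrictMono (cutSet v) := by
  refine Fin.strictMono_iff_lt_succ.2 fun i => ?_
  induction i using Fin.lastCases with
  | last =>
    rw [Fin.succ_last, cutSet_last, cutSet_castSucc]
    exact Finset.ssubset_univ_iff.2 fun h => last_notMem_differSet (h ▸ Finset.mem_univ _)
  | cast i =>
    rw [← Fin.castSucc_succ, cutSet_castSucc, cutSet_castSucc]
    refine (differSet_subset_differSet (hv.monotone (Fin.zero_le _))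
      (hv.monotone i.castSucc_lt_succ.le)).ssubset_of_ne fun h => (hv i.castSucc_lt_succ).ne ?_
    rw [← shift_differSet (hv.monotone (Fin.zero_le i.castSucc)) (hcube _), h,
      shift_differSet (hv.monotone (Fin.zero_le _)) (hcube _)]

theorem block_eq_cutSet_sdiff (hv : Monotone v) (hcube : ∀ i, v i ≤ v 0 + 1) (i : Fin (s + 1)) :
    block v i = cutSet v i.succ \ cutSet v i.castSucc := by
  induction i using Fin.lastCases with
  | last => simp [block, biUnion_stepSet hv]
  | cast i =>
    rw [block, Fin.snoc_castSucc, stepSet_eq_differSet, ← Fin.castSucc_succ, cutSet_castSucc,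
      cutSet_castSucc, differSet_sdiff_differSet (hv (Fin.zero_le _)) (hv i.castSucc_lt_succ.le)
        (hcube _)]

theorem block_nonempty (hv : StrictMono v) (hcube : ∀ i, v i ≤ v 0 + 1) (i : Fin (s + 1)) :
    (block v i).Nonempty := by
  rw [block_eq_cutSet_sdiff hv.monotone hcube, Finset.sdiff_nonempty]
  exact (strictMono_cutSet hv hcube i.castSucc_lt_succ).not_subset

theorem sum_card_sdiff_add_card {α : Type*} [DecidableEq α] {r : ℕ} {d : Fin (r + 1) → Finset α}
    (hd : Monotone d) :
    ∑ i : Fin r, (d i.succ \ d i.castSucc).card + (d 0).card = (d (Fin.last r)).card := by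
  induction r with
  | zero => simp
  | succ r ih =>
    have := ih (hd.comp Fin.strictMono_castSucc.monotone)
    have := Finset.card_sdiff_add_card_eq_card (hd (Fin.last r).castSucc_lt_succ.le)
    simp only [Function.comp_apply, Fin.sum_univ_castSucc, Fin.castSucc_zero, Fin.succ_last,
      Fin.succ_castSucc, Nat.succ_eq_add_one] at *
    omega

theorem sum_card_block (hv : StrictMono v) (hcube : ∀ i, v i ≤ v 0 + 1) :
    ∑ i, (block v i).card = n + 1 := by
  simp only [block_eq_cutSet_sdiff hv.monotone hcube]
  simpa [cutSet_zero] using sum_card_sdiff_add_card (strictMono_cutSet hv hcube).monotone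

theorem chainLengths_eq_fiberCards (hv : Monotone v) (hcube : ∀ i, v i ≤ v 0 + 1)
    (i : Fin (s + 1)) :
    chainLengths q v i =
      fiberCards (cutSet v i.succ \ cutSet v i.castSucc) (chainLabel q (v 0)) := by
  rw [← block_eq_cutSet_sdiff hv hcube]
  refine fiberCards_congr (S := block v i) (c := chainLabel q (v i)) fun l hl => ?_
  rw [block_eq_cutSet_sdiff hv hcube, cutSet_castSucc, Finset.coe_sdiff] at hl
  rw [chainLabel_eq_ite, chainLabel_eq_ite,
    ← not_not.1 (mt mem_differSet.2 hl.2)]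

theorem isFiberUpperSet_cutSet (hq : 1 ≤ q) (hL : ∀ i, v i ∈ latticePoints n q)
    (hv : Monotone v) (hcube : ∀ i, v i ≤ v 0 + 1) (j : Fin (s + 2)) :
    IsFiberUpperSet Finset.univ (chainLabel q (v 0)) (cyclicKey (v 0)) (cutSet v j) := by
  induction j using Fin.lastCases with
  | last =>
    rw [cutSet_last]
    exact ⟨Finset.Subset.refl _, fun _ _ m hm _ _ => hm⟩
  | cast j =>
    rw [cutSet_castSucc, ← shift_mem_latticePoints_iff_isFiberUpperSet hq (hL 0),
      shift_differSet (hv (Fin.zero_le j)) (hcube j)]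
    exact hL j

end CutSets

section Links

variable {n q s : ℕ} {v : Fin (s + 1) → Fin n → ℤ}

theorem mem_latticePoints_and_le_add_one_of_image_mem_faces (hq : 1 ≤ q)
    (hF : Finset.univ.image v ∈ (edgewise n q).faces) :
    (∀ i, v i ∈ latticePoints n q) ∧ ∀ i, v i ≤ v 0 + 1 := by
  rw [edgewise_eq_flagComplex hq] at hF
  obtain ⟨-, hL, hadj⟩ := hF
  have hmem (i) : v i ∈ Finset.univ.image v := Finset.mem_image_of_mem v (Finset.mem_univ i)
  exact ⟨fun i => hL _ (hmem i), fun i => (hadj _ (hmem 0) _ (hmem i)).le_add_one⟩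

theorem nonempty_orderIso_Ioo_fiberUpperSet {α β γ : Type*} [DecidableEq α] [DecidableEq β]
    [LinearOrder γ] {S : Finset α} {c : α → β} {key : α → γ} (hkey : Function.Injective key)
    {a b : FiberUpperSet S c key} (hab : a ≤ b) :
    Nonempty ({x : ChainProduct (fiberCards (b.1 \ a.1) c) // x ≠ ⊥ ∧ x ≠ ⊤} ≃o Set.Ioo a b) := by
  obtain ⟨f⟩ := nonempty_fiberUpperSet_orderIso_chainProduct (c := c) (S := b.1 \ a.1) hkey.injOn
  exact (nonempty_Ioo_orderIso_of_Icc_orderIso hab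
    ((FiberUpperSet.iccOrderIso hab).trans f)).map OrderIso.symm

theorem IsPairOfFace.link_isomorphic (hq : 1 ≤ q) {F : Finset (Fin n → ℤ)}
    (hF : F ∈ (edgewise n q).faces) {lam : (n + 1).Partition}
    {M : Multiset (Σ m : ℕ, m.Partition)} (h : IsPairOfFace q F lam M) :
    Isomorphic (link (edgewise n q) F) (joinOfChainProductComplexes M) := by
  obtain ⟨s, v, hv, rfl, -, hM⟩ := h
  obtain ⟨hL, hcube⟩ := mem_latticePoints_and_le_add_one_of_image_mem_faces hq hF
  let d (j) : FiberUpperSet Finset.univ (chainLabel q (v 0)) (cyclicKey (v 0)) :=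
    ⟨cutSet v j, isFiberUpperSet_cutSet hq hL hv.monotone hcube j⟩
  have hd : StrictMono d := strictMono_cutSet hv hcube
  have hbot : d 0 = ⊥ := Subtype.ext (cutSet_zero v)
  have htop : d (Fin.last (s + 1)) = ⊤ := Subtype.ext (cutSet_last v)
  obtain ⟨e, he⟩ := exists_toType_equiv_of_map_eq hM
  have hblock (i : M.ToType) : Nonempty ({x : ChainProduct i.1.2.parts // x ≠ ⊥ ∧ x ≠ ⊤} ≃o
      Set.Ioo (d (e i).castSucc) (d (e i).succ)) := by
    have hparts : i.1.2.parts = fiberCards ((d (e i).succ).1 \ (d (e i).castSucc).1)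
        (chainLabel q (v 0)) :=
      (he i).symm.trans (chainLengths_eq_fiberCards hv.monotone hcube (e i))
    rw [hparts]
    exact nonempty_orderIso_Ioo_fiberUpperSet (cyclicKey_injective _)
      (hd (e i).castSucc_lt_succ).le
  have himage : Finset.univ.image v =
      Finset.univ.image fun i : Fin (s + 1) => shift (v 0) (d i.castSucc).1 := by
    simp only [d, cutSet_castSucc, shift_differSet (hv.monotone (Fin.zero_le _)) (hcube _)]
  rw [himage] at hF ⊢
  exact (link_isomorphic_join_Ioo hq hd hbot htop hF).trans
    (join_orderComplex_congr e fun i => (hblock i).some).symm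

end Links

section Pairs

variable {n q : ℕ}

theorem exists_strictMono_image_univ_eq {P : Type*} [PartialOrder P] [DecidableEq P] {F : Finset P}
    (hne : F.Nonempty) (hF : IsChain (· ≤ ·) (F : Set P)) :
    ∃ (s : ℕ) (v : Fin (s + 1) → P), StrictMono v ∧ Finset.univ.image v = F := by
  classical
  obtain ⟨s, hs⟩ := Nat.exists_eq_succ_of_ne_zero hne.card_pos.ne'
  let _ : LinearOrder F := hF.linearOrder
  let g : Fin (s + 1) ≃o F := Fintype.orderIsoFinOfCardEq F ((Fintype.card_coe F).trans hs)
  refine ⟨s, fun i => (g i).1, fun i j hij => g.strictMono hij, Finset.ext fun w => ?_⟩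
  simp only [Finset.mem_image, Finset.mem_univ, true_and]
  exact ⟨fun ⟨i, hi⟩ => hi ▸ (g i).2, fun hw => ⟨g.symm ⟨w, hw⟩, by rw [g.apply_symm_apply]⟩⟩

theorem sigma_parts_injective :
    Function.Injective fun σ : Σ m : ℕ, m.Partition => σ.2.parts := by
  rintro ⟨m, σ⟩ ⟨m', σ'⟩ h
  obtain rfl : m = m' := by
    rw [← σ.parts_sum, ← σ'.parts_sum]
    exact congrArg Multiset.sum h
  exact congrArg (Sigma.mk m) (Nat.Partition.ext h)

theorem IsPairOfFace.unique {F : Finset (Fin n → ℤ)} {lam lam' : (n + 1).Partition}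
    {M M' : Multiset (Σ m : ℕ, m.Partition)} (h : IsPairOfFace q F lam M)
    (h' : IsPairOfFace q F lam' M') : lam' = lam ∧ M' = M := by
  obtain ⟨s, v, hv, rfl, hlam, hM⟩ := h
  obtain ⟨s', v', hv', hF, hlam', hM'⟩ := h'
  obtain rfl : s' = s := by
    simpa [Finset.card_image_of_injective, hv.injective, hv'.injective] using
      congrArg Finset.card hF
  obtain rfl : v' = v := (StrictMono.range_inj hv' hv).1 (by
    simpa using congrArg (fun s : Finset (Fin n → ℤ) => (s : Set (Fin n → ℤ))) hF)
  exact ⟨Nat.Partition.ext (hlam'.trans hlam.symm),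
    Multiset.map_injective sigma_parts_injective (hM'.trans hM.symm)⟩

theorem exists_isPairOfFace (hq : 1 ≤ q) {F : Finset (Fin n → ℤ)}
    (hF : F ∈ (edgewise n q).faces) :
    ∃ (lam : (n + 1).Partition) (M : Multiset (Σ m : ℕ, m.Partition)),
      lam.parts.card = F.card ∧ M.map (fun σ => σ.1) = lam.parts ∧ IsPairOfFace q F lam M := by
  have hchain : IsChain (· ≤ ·) (F : Set (Fin n → ℤ)) := by
    rw [edgewise_eq_flagComplex hq] at hF
    exact isChain_of_forall_adjacent hF.2.2
  obtain ⟨s, v, hv, rfl⟩ := exists_strictMono_image_univ_eq hF.1 hchain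
  have hcube := (mem_latticePoints_and_le_add_one_of_image_mem_faces hq hF).2
  let lam : (n + 1).Partition :=
    { parts := Finset.univ.val.map fun i => (block v i).card
      parts_pos := fun hm => by
        obtain ⟨i, -, rfl⟩ := Multiset.mem_map.1 hm
        exact (block_nonempty hv hcube i).card_pos
      parts_sum := sum_card_block hv hcube }
  let σ (i : Fin (s + 1)) : Σ m : ℕ, m.Partition := ⟨(block v i).card,
    { parts := fiberCards (block v i) (chainLabel q (v i))
      parts_pos := pos_of_mem_fiberCards
      parts_sum := sum_fiberCards _ _ }⟩
  refine ⟨lam, Finset.univ.val.map σ, ?_, Multiset.map_map _ _ _,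
    s, v, hv, rfl, rfl, Multiset.map_map _ _ _⟩
  simp [lam, Finset.card_image_of_injective _ hv.injective]

end Pairs

end EdgewiseLinks

theorem mainTheorem7 (n q : ℕ) (hq : 1 ≤ q) :
    (∀ (t : ℕ) (F : Finset (Fin n → ℤ)), F ∈ (EdgewiseLinks.edgewise n q).faces → F.card = t →
      ∃ (lam : (n + 1).Partition) (M : Multiset (Σ m : ℕ, m.Partition)),
        lam.parts.card = t ∧
        M.map (fun σ => σ.1) = lam.parts ∧
        EdgewiseLinks.IsPairOfFace q F lam M ∧
        (∀ (lam' : (n + 1).Partition) (M' : Multiset (Σ m : ℕ, m.Partition)),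
          EdgewiseLinks.IsPairOfFace q F lam' M' → lam' = lam ∧ M' = M) ∧
        EdgewiseLinks.Isomorphic
          (EdgewiseLinks.link (EdgewiseLinks.edgewise n q) F)
          (EdgewiseLinks.joinOfChainProductComplexes M)) ∧
    (∀ (F G : Finset (Fin n → ℤ)), F ∈ (EdgewiseLinks.edgewise n q).faces →
      G ∈ (EdgewiseLinks.edgewise n q).faces →
      ∀ (lam : (n + 1).Partition) (M : Multiset (Σ m : ℕ, m.Partition)),
        EdgewiseLinks.IsPairOfFace q F lam M → EdgewiseLinks.IsPairOfFace q G lam M →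
        EdgewiseLinks.Isomorphic
          (EdgewiseLinks.link (EdgewiseLinks.edgewise n q) F)
          (EdgewiseLinks.link (EdgewiseLinks.edgewise n q) G)) := by
  refine ⟨?_, fun F G hF hG lam M hFM hGM =>
    (hFM.link_isomorphic hq hF).trans (hGM.link_isomorphic hq hG).symm⟩
  rintro t F hF rfl
  obtain ⟨lam, M, hcard, hsize, hpair⟩ := EdgewiseLinks.exists_isPairOfFace hq hF
  exact ⟨lam, M, hcard, hsize, hpair, fun _ _ h => hpair.unique h, hpair.link_isomorphic hq hF⟩
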